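/- Let $R$ be an arbitrary (not necessarily commutative) ring with unit and let $A=(a_{ij})_{m\times m}$ be a right-quantum matrix over $R$, i.e. $$a_{jk}a_{ik}=a_{ik}a_{jk}\ \text{ for all } i,j,k,\qquad a_{ik}a_{jl}-a_{jk}a_{il}=a_{jl}a_{ik}-a_{il}a_{jk}\ \text{ for all } i,j \text{ and all } k\neq l .$$ Let $x_1,\dots,x_m$ be commuting variables that commute with $R$, let $X=\operatorname{diag}(x_1,\dots,x_m)$, and work in the ring $R[[x_1,\dots,x_m]]$ of formal power series. For vectors $p,r$ of nonnegative integers write $x^p=x_1^{p_1}\cdots x_m^{p_m}$ and let $G(p;r)$ be the coefficient of $x^r$ in the product, taken in this order, $$(Ax)^p=\Big(\sum_j a_{1j}x_j\Big)^{p_1}\cdots\Big(\sum_j a_{mj}x_j\Big)^{p_m}.$$ For $d\in\mathbb Z^m$ with $\sum_i d_i=0$ put $$F_A(d)=\sum_{p=r+d}G(p;r)\,x^p,$$ the sum being over all pairs $p,r$ of vectors of nonnegative integers with $p=r+d$. The determinant of a square matrix $B=(b_{ij})_{n\times n}$ with noncommuting entries is $\det B=\sum_{\sigma\in S_n}(-1)^{\operatorname{inv}\sigma}b_{\sigma(1)1}b_{\sigma(2)2}\cdots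 b_{\sigma(n)n}$, and for $I,J\subseteq\{1,\dots,m\}$ with $|I|=|J|$ the expression $\det(I-XA)^{I,J}$ denotes the determinant of the matrix obtained from $I-XA$ by removing the rows in $I$ and the columns in $J$ (in $I-XA$, $I$ is the identity matrix). Let $\mathcal M$ be the multiset of all $i$ with $d_i<0$, each taken $-d_i$ times, and $\mathcal N$ the multiset of all $i$ with $d_i>0$, each taken $d_i$ times. Let $M$ and $N$ be the sums of the elements of $\mathcal M$ and $\mathcal N$ (with multiplicity), let $S(\mathcal M)$ be the set of all (distinct) permutations of the multiset $\mathcal M$, and let $N_1,\dots,N_\delta$ be the elements of $\mathcal N$, with multiplicity, listed in any order. For $\pi=\pi_1\cdots\pi_\delta\in S(\mathcal M)$ and $1\le k\le\delta$ let $I_\pi^k=\{\pi_1,\dots,\pi_k\}$ (a set), $I_\pi^0=\varnothing$, $J_\pi^k=(I_\pi^k\setminus\{\pi_k\})\cup\{N_k\}$, and let $\varepsilon_\pi^k$ be the number of elements of $I_\pi^{k-1}$ in the open interval between $\pi_k$ and $N_k$. Then $\det(I-XA)$ and all $\det(I-XA)^{I,I}$, $I\subseteq\{1,\dots,m\}$,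 are invertible in $R[[x_1,\dots,x_m]]$, and for every $d\in\mathbb Z^m$ with $\sum_i d_i=0$ the following hold. The multisets $\mathcal M$ and $\mathcal N$ have the same cardinality $\delta$. The series $F_A(d)$ is a noncommutative rational function of $x_1,\dots,x_m$ with coefficients polynomials in the $a_{ij}$, i.e. it lies in the smallest subset of $R[[x_1,\dots,x_m]]$ that contains the $x_i$ and all polynomials with integer coefficients in the $a_{ij}$ and is closed under sums, products and two-sided inverses. Moreover $$F_A(d)=\frac{(-1)^{M+N}}{\det(I-XA)}\sum_{\pi\in S(\mathcal M)}\ \prod_{k=1}^{\delta}(-1)^{\varepsilon_\pi^k}\cdot\det(I-XA)^{I_\pi^k,J_\pi^k}\cdot\frac1{\det(I-XA)^{I_\pi^k,I_\pi^k}},$$ where the factors of the product are multiplied from left to right in the order $k=1,\dots,\delta$. In particular, for $d=0$, $$F_A(0)=\frac1{\det(I-XA)}$$ (the right-quantum MacMahon master theorem). -/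

import Mathlib

/-- A square matrix with entries in a (not necessarily commutative) ring is right-quantum if
entries of the same column commute and the cross-commutator relations hold for any two distinct
columns. -/
def IsRightQuantum {R : Type*} [Ring R] {m : ℕ} (A : Matrix (Fin m) (Fin m) R) : Prop :=
  (∀ i j k, A j k * A i k = A i k * A j k) ∧
  ∀ i j k l, k ≠ l →
    A i k * A j l - A j k * A i l = A j l * A i k - A i l * A j k

/-- The determinant of a matrix over a not necessarily commutative ring, expanded in the order of
the columns: `∑ σ, (-1) ^ inv σ * (B (σ 1) 1 * B (σ 2) 2 * ⋯ * B (σ n) n)`. -/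
def ncDet {S : Type*} [Ring S] {n : ℕ} (B : Matrix (Fin n) (Fin n) S) : S :=
  ∑ σ : Equiv.Perm (Fin n),
    ((Equiv.Perm.sign σ : ℤ) : S) * (List.ofFn fun j : Fin n => B (σ j) j).prod

/-- `ncMinor B I J` is the determinant of the matrix obtained from `B` by removing the rows in `I`
and the columns in `J`, the remaining rows and columns being kept in increasing order. It is used
only for `I` and `J` of the same size (otherwise the remaining matrix is not square, and the value
is set to `0`). -/
noncomputable def ncMinor {S : Type*} [Ring S] {m : ℕ} (B : Matrix (Fin m) (Fin m) S)
    (I J : Finset (Fin m)) : S :=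
  if h : Jᶜ.card = Iᶜ.card then
    ncDet (B.submatrix (Iᶜ.orderEmbOfFin rfl) (Jᶜ.orderEmbOfFin h))
  else 0

/-- The matrix `1 - X A`, where `X = diag (x_1, …, x_m)`, over the ring of formal power series in
commuting variables `x_1, …, x_m` that commute with the coefficients. -/
noncomputable def oneSubXA {R : Type*} [Ring R] {m : ℕ} (A : Matrix (Fin m) (Fin m) R) :
    Matrix (Fin m) (Fin m) (MvPowerSeries (Fin m) R) :=
  1 - Matrix.diagonal (fun i => MvPowerSeries.X i) * A.map (MvPowerSeries.C (σ := Fin m))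

/-- `macG A p r` is the coefficient of `x ^ r` in
`(A x) ^ p = (∑ j, a_{1j} x_j) ^ p_1 * ⋯ * (∑ j, a_{mj} x_j) ^ p_m` (product in this order). -/
noncomputable def macG {R : Type*} [Ring R] {m : ℕ} (A : Matrix (Fin m) (Fin m) R)
    (p r : Fin m →₀ ℕ) : R :=
  MvPowerSeries.coeff r
    (List.ofFn fun i : Fin m =>
      (∑ j : Fin m, MvPowerSeries.C (σ := Fin m) (A i j) * MvPowerSeries.X j) ^ p i).prod

/-- The generating function `∑ G(p; r) x ^ p` over all pairs of vectors `p, r` of nonnegative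
integers with `p = r + d`. The coefficient of `x ^ p` is `G(p; p - d)` if `p - d` is nonnegative,
and `0` otherwise. -/
noncomputable def macF {R : Type*} [Ring R] {m : ℕ} (A : Matrix (Fin m) (Fin m) R)
    (d : Fin m → ℤ) : MvPowerSeries (Fin m) R :=
  fun p : Fin m →₀ ℕ =>
    if ∀ i, 0 ≤ (p i : ℤ) - d i then
      macG A p (Finsupp.equivFunOnFinite.symm fun i => ((p i : ℤ) - d i).toNat)
    else 0

/-- The multiset of all `i` with `d i > 0`, each `i` appearing `d i` times. -/
def posMultiset {m : ℕ} (d : Fin m → ℤ) : Multiset (Fin m) :=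
  ∑ i, Multiset.replicate (d i).toNat i

/-- The multiset of all `i` with `d i < 0`, each `i` appearing `-d i` times. -/
def negMultiset {m : ℕ} (d : Fin m → ℤ) : Multiset (Fin m) :=
  ∑ i, Multiset.replicate (-d i).toNat i

/-- The sum of the elements of a multiset of indices, the indices being numbered `1, …, m`. -/
def indexSum {m : ℕ} (s : Multiset (Fin m)) : ℕ :=
  (s.map fun i => (i : ℕ) + 1).sum

/-- `w` lists the elements of the multiset `s`, i.e. `w` is a permutation of the multiset `s`. -/
abbrev Enumerates {m δ : ℕ} (w : Fin δ → Fin m) (s : Multiset (Fin m)) : Prop :=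
  (Finset.univ : Finset (Fin δ)).val.map w = s

/-- The set `{π_1, …, π_k}`. -/
def headSet {m δ : ℕ} (π : Fin δ → Fin m) (k : Fin δ) : Finset (Fin m) :=
  (Finset.Iic k).image π

/-- The set `{π_1, …, π_{k-1}}`. -/
def prevSet {m δ : ℕ} (π : Fin δ → Fin m) (k : Fin δ) : Finset (Fin m) :=
  (Finset.Iio k).image π

/-- The set `({π_1, …, π_k} \ {π_k}) ∪ {N_k}`. -/
def swapSet {m δ : ℕ} (N π : Fin δ → Fin m) (k : Fin δ) : Finset (Fin m) :=
  (headSet π k \ {π k}) ∪ {N k}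

/-- The number of elements of `{π_1, …, π_{k-1}}` in the open interval between `π_k` and `N_k`. -/
def crossCount {m δ : ℕ} (N π : Fin δ → Fin m) (k : Fin δ) : ℕ :=
  (prevSet π k ∩ Finset.Ioo (min (π k) (N k)) (max (π k) (N k))).card

/-- Noncommutative rational functions in `x_1, …, x_m` with coefficients polynomials in the
entries of `A`, as a subset of the ring of formal power series: the smallest set that contains the
polynomials in the entries of `A` and the variables and is closed under sums, products and
(two-sided) inverses. -/
inductive IsRationalIn {R : Type*} [Ring R] {m : ℕ} (A : Matrix (Fin m) (Fin m) R) :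
    MvPowerSeries (Fin m) R → Prop
  | coeff (c : R) (hc : c ∈ Subring.closure (Set.range fun ij : Fin m × Fin m => A ij.1 ij.2)) :
      IsRationalIn A (MvPowerSeries.C c)
  | var (i : Fin m) : IsRationalIn A (MvPowerSeries.X i)
  | add {f g : MvPowerSeries (Fin m) R} :
      IsRationalIn A f → IsRationalIn A g → IsRationalIn A (f + g)
  | mul {f g : MvPowerSeries (Fin m) R} :
      IsRationalIn A f → IsRationalIn A g → IsRationalIn A (f * g)
  | inv {f g : MvPowerSeries (Fin m) R} :
      IsRationalIn A f → f * g = 1 → g * f = 1 → IsRationalIn A g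

/-!
The matrix `C = 1 - X A` is itself right-quantum, since right-quantumness is a condition on
commutators and adding central scalars to the entries does not affect it. For a right-quantum matrix
the column-ordered determinant is alternating in the columns (`ncDet_submatrix_columns`,
`ncDet_eq_zero_of_column_eq_last`), and expansion along the last column needs no commutativity at
all (`ncDet_succ_last_column`). Together they give a version of Cramer's rule
(`ncMinor_mul_eq_sum`): in the linear system formed by the rows of `C` outside a set `I`, with the
unknowns indexed by `I` considered as known, each other unknown times `det C^{I,I}` is a signed sum
of minors of `C` times known quantities.

The second consequence of right-quantumness is that the linear forms `∑ j, a_{ij} x_j` commute, so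
that in `(A x) ^ p` any factor with `p i > 0` can be moved to the front. Let `F^I(d)`
(`restrF A I d`) be the part of `F_A(d)` with `p i = 0` for all `i ∈ I`. Distinguishing `p i = 0`
from `p i > 0` yields, for `i ∉ I`,
`∑ j, C i j * F^I(e_j + d) = F^{I ∪ {i}}(e_i + d)` (`sum_oneSubXA_mul_restrF`), while for `i ∈ I`
trivially `F^I(e_i + d) = F^{I ∪ {i}}(e_i + d)`. Cramer's rule expresses `F^I(e_i + d)` through
the series `F^{I ∪ {k}}(e_k + d)` (`ncMinor_mul_restrF`), and these vanish unless `d k < 0`.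

For `d = -e_i` only `k = i` contributes, and induction on the complement of `I` gives
`F^I(0) = 1 / det C^{I,I}` (`ncMinor_mul_restrF_zero`), which for `I = ∅` is the master theorem. In
general each application removes one element `N_1` from the positive part of `d` and one element
`k = π_1` from the negative part, and adds `k` to `I`; iterating until `d = 0` produces the sum over
the permutations `π` of the negative part (`ncMinor_mul_restrF_displacement`). Rationality is read
off from the resulting formula.
-/

/-! ### Determinants with noncommuting entries -/

section NcDet

variable {S : Type*} [Ring S]

theorem IsRightQuantum.submatrix {m n : ℕ} {A : Matrix (Fin m) (Fin m) S} (hA : IsRightQuantum A)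
    (f g : Fin n → Fin m) : IsRightQuantum (A.submatrix f g) := by
  refine ⟨fun i j k => hA.1 _ _ _, fun i j k l _ => ?_⟩
  simp only [Matrix.submatrix_apply]
  by_cases h : g k = g l
  · rw [h, hA.1 (f i) (f j)]
  · exact hA.2 _ _ _ _ h

theorem ncDet_one {n : ℕ} : ncDet (1 : Matrix (Fin n) (Fin n) S) = 1 := by
  rw [ncDet, Finset.sum_eq_single 1]
  · have h : (fun j : Fin n => (1 : Matrix (Fin n) (Fin n) S) ((1 : Equiv.Perm (Fin n)) j) j) =
        fun _ => 1 := funext fun j => Matrix.one_apply_eq j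
    rw [h]
    simp [List.ofFn_const]
  · intro σ _ hσ
    obtain ⟨j, hj⟩ : ∃ j, σ j ≠ j := by
      by_contra! h
      exact hσ (Equiv.ext h)
    rw [List.prod_eq_zero, mul_zero]
    rw [List.mem_ofFn]
    exact ⟨j, Matrix.one_apply_ne hj⟩
  · simp

theorem map_ncDet {S' : Type*} [Ring S'] (φ : S →+* S') {n : ℕ} (B : Matrix (Fin n) (Fin n) S) :
    φ (ncDet B) = ncDet (B.map φ) := by
  simp [ncDet, map_sum, map_list_prod, List.map_ofFn, Function.comp_def]

/-- If the values of `f₁`, `f₂`, `f₃`, `f₄` agree away from two adjacent positions, a linear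
relation between the products of the two adjacent values extends to the full products. -/
theorem prod_ofFn_sub_add_sub_eq_zero {n : ℕ} (t : Fin n) (f₁ f₂ f₃ f₄ : Fin (n + 1) → S)
    (h₂ : ∀ j, j ≠ t.castSucc → j ≠ t.succ → f₂ j = f₁ j)
    (h₃ : ∀ j, j ≠ t.castSucc → j ≠ t.succ → f₃ j = f₁ j)
    (h₄ : ∀ j, j ≠ t.castSucc → j ≠ t.succ → f₄ j = f₁ j)
    (h : f₁ t.castSucc * f₁ t.succ - f₂ t.castSucc * f₂ t.succ +
      (f₃ t.castSucc * f₃ t.succ - f₄ t.castSucc * f₄ t.succ) = 0) :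
    (List.ofFn f₁).prod - (List.ofFn f₂).prod +
      ((List.ofFn f₃).prod - (List.ofFn f₄).prod) = 0 := by
  induction n with
  | zero => exact t.elim0
  | succ n ih =>
    refine Fin.cases (fun h₂ h₃ h₄ h => ?_) (fun s h₂ h₃ h₄ h => ?_) t h₂ h₃ h₄ h
    · have key : ∀ f : Fin (n + 2) → S, (∀ j, j ≠ 0 → j ≠ 1 → f j = f₁ j) →
          (List.ofFn f).prod = f 0 * f 1 * (List.ofFn fun j : Fin n => f₁ j.succ.succ).prod := by
        intro f hf
        rw [List.ofFn_succ, List.ofFn_succ, List.prod_cons, List.prod_cons, mul_assoc]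
        congr 4
        funext j
        exact hf _ (Fin.succ_ne_zero _) (by
          rw [← Fin.succ_zero_eq_one, Ne, Fin.succ_inj]
          exact Fin.succ_ne_zero _)
      rw [key f₁ (fun _ _ _ => rfl), key f₂ h₂, key f₃ h₃, key f₄ h₄, ← sub_mul, ← sub_mul,
        ← add_mul]
      have h' : f₁ 0 * f₁ 1 - f₂ 0 * f₂ 1 + (f₃ 0 * f₃ 1 - f₄ 0 * f₄ 1) = 0 := h
      rw [h', zero_mul]
    · have h0 : (0 : Fin (n + 2)) ≠ s.succ.castSucc := by
        rw [← Fin.succ_castSucc]; exact (Fin.succ_ne_zero _).symm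
      have h0' : (0 : Fin (n + 2)) ≠ s.succ.succ := (Fin.succ_ne_zero _).symm
      have hs : ∀ {f : Fin (n + 2) → S}, (∀ j, j ≠ s.succ.castSucc → j ≠ s.succ.succ →
          f j = f₁ j) → ∀ j, j ≠ s.castSucc → j ≠ s.succ → f j.succ = f₁ j.succ := by
        intro f hf j h1 h2
        refine hf _ ?_ (fun h => h2 (Fin.succ_injective _ h))
        rw [← Fin.succ_castSucc]
        exact fun h => h1 (Fin.succ_injective _ h)
      have := ih s (fun j => f₁ j.succ) (fun j => f₂ j.succ) (fun j => f₃ j.succ)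
        (fun j => f₄ j.succ) (hs h₂) (hs h₃) (hs h₄) (by simpa only [Fin.succ_castSucc] using h)
      simp only [List.ofFn_succ (f := f₁), List.ofFn_succ (f := f₂), List.ofFn_succ (f := f₃),
        List.ofFn_succ (f := f₄), List.prod_cons, h₂ 0 h0 h0', h₃ 0 h0 h0', h₄ 0 h0 h0']
      rw [← mul_sub, ← mul_sub, ← mul_add, this, mul_zero]

/-- Interchanging two adjacent columns `k`, `l` changes the sign: collecting the permutations that
differ by the two values at these columns leaves the relation
`c_{ik} c_{jl} - c_{jk} c_{il} + (c_{il} c_{jk} - c_{jl} c_{ik}) = 0` between adjacent factors. -/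
theorem ncDet_swap_adjacent_columns {n : ℕ} {D : Matrix (Fin (n + 1)) (Fin (n + 1)) S}
    (hD : IsRightQuantum D) (t : Fin n) :
    ncDet (D.submatrix id (Equiv.swap t.castSucc t.succ)) = -ncDet D := by
  have hne : t.castSucc ≠ t.succ := Fin.castSucc_lt_succ.ne
  rw [eq_neg_iff_add_eq_zero, ncDet, ncDet, ← Finset.sum_add_distrib]
  refine Finset.sum_involution (fun σ _ => σ * Equiv.swap t.castSucc t.succ) ?_ ?_ ?_ ?_
  · intro σ _
    have := prod_ofFn_sub_add_sub_eq_zero t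
      (fun j => D (σ j) j)
      (fun j => D (σ (Equiv.swap t.castSucc t.succ j)) j)
      (fun j => D (σ j) (Equiv.swap t.castSucc t.succ j))
      (fun j => D (σ (Equiv.swap t.castSucc t.succ j)) (Equiv.swap t.castSucc t.succ j))
      (fun j h1 h2 => by rw [Equiv.swap_apply_of_ne_of_ne h1 h2])
      (fun j h1 h2 => by rw [Equiv.swap_apply_of_ne_of_ne h1 h2])
      (fun j h1 h2 => by rw [Equiv.swap_apply_of_ne_of_ne h1 h2])
      (by
        simp only [Equiv.swap_apply_left, Equiv.swap_apply_right]
        rw [hD.2 _ _ _ _ hne]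
        abel)
    simp only [Matrix.submatrix_apply, id, map_mul, Equiv.Perm.sign_swap hne, Equiv.Perm.coe_mul,
      Function.comp_apply, mul_neg, mul_one, Units.val_neg, Int.cast_neg, neg_mul]
    rw [← mul_zero ((Equiv.Perm.sign σ : ℤ) : S), ← this]
    noncomm_ring
  · intro σ _ _ h
    exact hne (Equiv.swap_eq_one_iff.1 (mul_eq_left.1 h))
  · intro σ _
    exact Finset.mem_univ _
  · intro σ _
    simp [mul_assoc]

theorem ncDet_eq_zero_of_adjacent_columns_eq {n : ℕ} {D : Matrix (Fin (n + 1)) (Fin (n + 1)) S}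
    (hD : IsRightQuantum D) (t : Fin n) (h : ∀ i, D i t.castSucc = D i t.succ) :
    ncDet D = 0 := by
  have hne : t.castSucc ≠ t.succ := Fin.castSucc_lt_succ.ne
  refine Finset.sum_involution (fun σ _ => σ * Equiv.swap t.castSucc t.succ) ?_ ?_ ?_ ?_
  · intro σ _
    have := prod_ofFn_sub_add_sub_eq_zero t
      (fun j => D (σ j) j)
      (fun j => D (σ (Equiv.swap t.castSucc t.succ j)) j)
      (fun j => D (σ j) j) (fun j => D (σ j) j)
      (fun j h1 h2 => by rw [Equiv.swap_apply_of_ne_of_ne h1 h2])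
      (fun j h1 h2 => rfl) (fun j h1 h2 => rfl)
      (by
        simp only [Equiv.swap_apply_left, Equiv.swap_apply_right, h]
        rw [hD.1, sub_self, add_zero])
    simp only [map_mul, Equiv.Perm.sign_swap hne, Equiv.Perm.coe_mul,
      Function.comp_apply, mul_neg, mul_one, Units.val_neg, Int.cast_neg, neg_mul]
    rw [← sub_eq_add_neg, ← mul_sub]
    rw [sub_self, add_zero] at this
    rw [this, mul_zero]
  · intro σ _ _ h
    exact hne (Equiv.swap_eq_one_iff.1 (mul_eq_left.1 h))
  · intro σ _
    exact Finset.mem_univ _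
  · intro σ _
    simp [mul_assoc]

theorem ncDet_submatrix_columns {n : ℕ} {D : Matrix (Fin n) (Fin n) S} (hD : IsRightQuantum D)
    (τ : Equiv.Perm (Fin n)) :
    ncDet (D.submatrix id τ) = ((Equiv.Perm.sign τ : ℤ) : S) * ncDet D := by
  cases n with
  | zero => 
    rw [Subsingleton.elim τ 1]
    simp
  | succ n =>
    have hτ : τ ∈ Submonoid.closure
        (Set.range fun i : Fin n => Equiv.swap i.castSucc i.succ) := by
      rw [Equiv.Perm.mclosure_swap_castSucc_succ]; trivial
    induction hτ using Submonoid.closure_induction_right generalizing D with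
    | one => simp
    | mul_right σ hσ s hs ih =>
      obtain ⟨t, rfl⟩ := hs
      have := ncDet_swap_adjacent_columns (hD.submatrix id σ) t
      rw [Matrix.submatrix_submatrix] at this
      simp only [Equiv.Perm.coe_mul]
      have hne : t.castSucc ≠ t.succ := Fin.castSucc_lt_succ.ne
      rw [Function.comp_id] at this
      rw [this, ih hD, map_mul, Equiv.Perm.sign_swap hne]
      simp

/-- A repeated column is first moved next to the last one, where entries of the same column
commute. -/
theorem ncDet_eq_zero_of_column_eq_last {n : ℕ} {D : Matrix (Fin (n + 1)) (Fin (n + 1)) S}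
    (hD : IsRightQuantum D) (j : Fin n) (h : ∀ i, D i j.castSucc = D i (Fin.last n)) :
    ncDet D = 0 := by
  cases n with
  | zero => exact j.elim0
  | succ n =>
    have h0 := ncDet_submatrix_columns hD (Equiv.swap j.castSucc (Fin.last n).castSucc)
    rw [ncDet_eq_zero_of_adjacent_columns_eq (hD.submatrix id _) (Fin.last n)] at h0
    · rcases Int.units_eq_one_or
        (Equiv.Perm.sign (Equiv.swap j.castSucc (Fin.last n).castSucc)) with h1 | h1 <;>
      · rw [h1] at h0
        simpa using h0.symm
    · intro i
      have h1 : Equiv.swap j.castSucc (Fin.last n).castSucc (Fin.last n).succ =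
          Fin.last (n + 1) := by
        rw [Fin.succ_last]
        exact Equiv.swap_apply_of_ne_of_ne (Fin.castSucc_lt_last _).ne'
          (Fin.castSucc_lt_last _).ne'
      simp only [Matrix.submatrix_apply, Equiv.swap_apply_right, id]
      rw [h1, h i]

/-- The permutation that sends the last index to `k` and acts on the others by `τ`, that is
`castSucc j ↦ k.succAbove (τ j)` and `last ↦ k`. -/
def snocPerm {n : ℕ} (k : Fin (n + 1)) (τ : Equiv.Perm (Fin n)) : Equiv.Perm (Fin (n + 1)) :=
  k.cycleRange.symm * Equiv.Perm.decomposeFin.symm (0, τ) * finRotate (n + 1)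

theorem snocPerm_castSucc {n : ℕ} (k : Fin (n + 1)) (τ : Equiv.Perm (Fin n)) (j : Fin n) :
    snocPerm k τ j.castSucc = k.succAbove (τ j) := by
  simp [snocPerm]

theorem snocPerm_last {n : ℕ} (k : Fin (n + 1)) (τ : Equiv.Perm (Fin n)) :
    snocPerm k τ (Fin.last n) = k := by
  simp [snocPerm]

theorem sign_snocPerm {n : ℕ} (k : Fin (n + 1)) (τ : Equiv.Perm (Fin n)) :
    Equiv.Perm.sign (snocPerm k τ) = (-1) ^ (n + (k : ℕ)) * Equiv.Perm.sign τ := by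
  rw [snocPerm, map_mul, map_mul]
  simp [Fin.sign_cycleRange, pow_add, mul_comm, ← mul_assoc]

theorem snocPerm_bijective (n : ℕ) :
    Function.Bijective fun q : Fin (n + 1) × Equiv.Perm (Fin n) => snocPerm q.1 q.2 := by
  rw [Fintype.bijective_iff_injective_and_card]
  constructor
  · rintro ⟨k, τ⟩ ⟨k', τ'⟩ h
    have h1 : k = k' := by
      have := DFunLike.congr_fun h (Fin.last n)
      simpa [snocPerm_last] using this
    subst h1
    refine Prod.ext rfl (Equiv.ext fun j => ?_)
    have := DFunLike.congr_fun h j.castSucc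
    simpa [snocPerm_castSucc] using this
  · simp [Fintype.card_perm, Nat.factorial_succ]

/-- Laplace expansion along the last column. As the last column comes last in every product, this
needs no commutation relations. -/
theorem ncDet_succ_last_column {n : ℕ} (D : Matrix (Fin (n + 1)) (Fin (n + 1)) S) :
    ncDet D = ∑ k : Fin (n + 1), (-1) ^ (n + (k : ℕ)) *
      ncDet (D.submatrix k.succAbove Fin.castSucc) * D k (Fin.last n) := by
  rw [ncDet, ← (Equiv.ofBijective _ (snocPerm_bijective n)).sum_comp, Fintype.sum_prod_type]
  refine Finset.sum_congr rfl fun k _ => ?_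
  rw [ncDet, Finset.mul_sum, Finset.sum_mul]
  refine Finset.sum_congr rfl fun τ _ => ?_
  simp only [Equiv.ofBijective_apply, sign_snocPerm, List.ofFn_succ', snocPerm_castSucc,
    snocPerm_last, Matrix.submatrix_apply, List.concat_eq_append, List.prod_append,
    List.prod_singleton]
  push_cast
  simp only [mul_assoc]

end NcDet

/-! ### Minors and Cramer's rule -/

section Minors

variable {S : Type*} [Ring S] {m : ℕ}

/-- The minor of `B` on the rows in `U` and the columns in `V`, both in increasing order; as for
`ncMinor`, the value is `0` if `U` and `V` have different sizes. -/
noncomputable def subDet (B : Matrix (Fin m) (Fin m) S) (U V : Finset (Fin m)) : S :=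
  if h : V.card = U.card then
    ncDet (B.submatrix (U.orderEmbOfFin rfl) (V.orderEmbOfFin h))
  else 0

theorem subDet_compl (B : Matrix (Fin m) (Fin m) S) (I J : Finset (Fin m)) :
    subDet B Iᶜ Jᶜ = ncMinor B I J := rfl

theorem subDet_eq (B : Matrix (Fin m) (Fin m) S) {U V : Finset (Fin m)} {n : ℕ}
    (hU : U.card = n) (hV : V.card = n) :
    subDet B U V = ncDet (B.submatrix (U.orderEmbOfFin hU) (V.orderEmbOfFin hV)) := by
  subst hU
  rw [subDet, dif_pos hV]

theorem orderEmbOfFin_succAbove {U : Finset (Fin m)} {n : ℕ} (hU : U.card = n + 1)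
    (k : Fin (n + 1)) (h : (U.erase (U.orderEmbOfFin hU k)).card = n) (j : Fin n) :
    U.orderEmbOfFin hU (k.succAbove j) = (U.erase (U.orderEmbOfFin hU k)).orderEmbOfFin h j := by
  refine congrFun (Finset.orderEmbOfFin_unique (f := fun j => U.orderEmbOfFin hU (k.succAbove j))
    h (fun j => ?_) ?_) j
  · rw [Finset.mem_erase]
    refine ⟨fun h => ?_, Finset.orderEmbOfFin_mem _ _ _⟩
    exact Fin.succAbove_ne _ _ ((U.orderEmbOfFin hU).injective h)
  · exact (U.orderEmbOfFin hU).strictMono.comp (Fin.strictMono_succAbove k)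

theorem card_filter_orderEmbOfFin_lt {U : Finset (Fin m)} {n : ℕ} (hU : U.card = n + 1)
    (k : Fin (n + 1)) : (U.filter (U.orderEmbOfFin hU k < ·)).card = n - k := by
  have : U.filter (U.orderEmbOfFin hU k < ·) =
      (Finset.Ioi k).map (U.orderEmbOfFin hU).toEmbedding := by
    ext x
    simp only [Finset.mem_filter, Finset.mem_map, Finset.mem_Ioi]
    constructor
    · rintro ⟨hx, hlt⟩
      rw [← Finset.mem_coe, ← Finset.range_orderEmbOfFin U hU] at hx
      obtain ⟨j, rfl⟩ := hx
      exact ⟨j, (U.orderEmbOfFin hU).lt_iff_lt.1 hlt, rfl⟩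
    · rintro ⟨j, hj, rfl⟩
      exact ⟨Finset.orderEmbOfFin_mem _ _ _, (U.orderEmbOfFin hU).lt_iff_lt.2 hj⟩
  rw [this, Finset.card_map, Fin.card_Ioi]
  omega

/-- The number of elements of `U` above `i`. -/
def numAbove (U : Finset (Fin m)) (i : Fin m) : ℕ := (U.filter (i < ·)).card

theorem neg_one_pow_numAbove {U : Finset (Fin m)} {n : ℕ} (hU : U.card = n + 1)
    (k : Fin (n + 1)) :
    (-1 : S) ^ numAbove U (U.orderEmbOfFin hU k) = (-1) ^ (n + (k : ℕ)) := by
  rw [numAbove, card_filter_orderEmbOfFin_lt hU k]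
  have : n + (k : ℕ) = (n - k) + 2 * k := by omega
  rw [this, pow_add _ _ (2 * (k : ℕ)), pow_mul]
  simp

/-- Laplace expansion along a further column `j`, appended to the columns in `V`: the outcome is
`0` if `j` already belongs to `V`, and otherwise a minor, up to the sign of sorting `j` into `V`. -/
theorem sum_subDet_erase_mul {C : Matrix (Fin m) (Fin m) S} (hC : IsRightQuantum C)
    {T V : Finset (Fin m)} (hTV : T.card = V.card + 1) (j : Fin m) :
    ∑ t ∈ T, (-1) ^ numAbove T t * subDet C (T.erase t) V * C t j =
      if j ∈ V then 0 else (-1) ^ numAbove V j * subDet C T (insert j V) := by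
  set n := V.card with hn
  set e := T.orderEmbOfFin hTV with he
  set v := V.orderEmbOfFin hn.symm with hv
  set g : Fin (n + 1) → Fin m := Fin.snoc v j with hg
  have hcast : ∀ a : Fin n, g a.castSucc = v a := fun a => by simp [hg]
  have hlast : g (Fin.last n) = j := by simp [hg]
  have hexp : ∑ t ∈ T, (-1) ^ numAbove T t * subDet C (T.erase t) V * C t j =
      ncDet (C.submatrix e g) := by
    rw [ncDet_succ_last_column, ← Finset.sum_coe_sort T,
      ← (T.orderIsoOfFin hTV).toEquiv.sum_comp]
    refine Finset.sum_congr rfl fun k _ => ?_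
    have hk : ((T.orderIsoOfFin hTV).toEquiv k : Fin m) = e k := rfl
    rw [hk, neg_one_pow_numAbove, Matrix.submatrix_apply, hlast, Matrix.submatrix_submatrix]
    have hcard : (T.erase (e k)).card = n := by
      rw [Finset.card_erase_of_mem (Finset.orderEmbOfFin_mem _ _ _), hTV]; rfl
    rw [subDet_eq C hcard hn.symm]
    congr 3
    ext a b
    simp only [Matrix.submatrix_apply, Function.comp_apply, hcast]
    exact congrFun (congrArg C (orderEmbOfFin_succAbove hTV k hcard a).symm) (v b)
  rw [hexp]
  split_ifs with hj
  · rw [← Finset.mem_coe, ← Finset.range_orderEmbOfFin V hn.symm] at hj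
    obtain ⟨a, ha⟩ := hj
    refine ncDet_eq_zero_of_column_eq_last (hC.submatrix e g) a fun i => ?_
    rw [Matrix.submatrix_apply, Matrix.submatrix_apply, hcast, hlast, ← ha]
  · have hcard : (insert j V).card = n + 1 := by rw [Finset.card_insert_of_notMem hj]
    have hmem : j ∈ (insert j V : Finset (Fin m)) := Finset.mem_insert_self _ _
    rw [← Finset.mem_coe, ← Finset.range_orderEmbOfFin _ hcard] at hmem
    obtain ⟨q, hq⟩ := hmem
    have herase : (insert j V).erase ((insert j V).orderEmbOfFin hcard q) = V := by
      rw [hq, Finset.erase_insert hj]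
    have hcomp : C.submatrix e g = (C.submatrix e ((insert j V).orderEmbOfFin hcard)).submatrix id
        (snocPerm q 1) := by
      ext a b
      simp only [Matrix.submatrix_apply, id]
      congr 1
      refine Fin.lastCases ?_ (fun b => ?_) b
      · rw [hlast, snocPerm_last, hq]
      · rw [hcast, snocPerm_castSucc, orderEmbOfFin_succAbove hcard q (by rw [herase])]
        simp only [herase, Equiv.Perm.one_apply, hv]
    have hsign : (-1 : S) ^ numAbove V j = (-1) ^ (n + (q : ℕ)) := by
      rw [← neg_one_pow_numAbove hcard q, hq, numAbove, numAbove, Finset.filter_insert,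
        if_neg (lt_irrefl j)]
    rw [hcomp, ncDet_submatrix_columns (hC.submatrix _ _), sign_snocPerm, subDet_eq C hTV hcard,
      hsign]
    simp [he]

/-- The number of elements of `I` in the open interval between `k` and `i`; `crossCount N π k` is
the case `I = prevSet π k` with end points `π k` and `N k`. -/
def numBetween (I : Finset (Fin m)) (k i : Fin m) : ℕ :=
  (I ∩ Finset.Ioo (min k i) (max k i)).card

theorem numAbove_add_numAbove_compl (I : Finset (Fin m)) (i : Fin m) :
    numAbove I i + numAbove Iᶜ i + i + 1 = m := by
  have h : numAbove I i + numAbove Iᶜ i = (Finset.Ioi i).card := by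
    rw [numAbove, numAbove, ← Finset.card_union_of_disjoint]
    · congr 1
      ext x
      simp only [Finset.mem_union, Finset.mem_filter, Finset.mem_compl, Finset.mem_Ioi]
      tauto
    · exact Finset.disjoint_filter_filter (disjoint_compl_right)
  rw [h, Fin.card_Ioi]
  omega

theorem numAbove_erase (T : Finset (Fin m)) (i j : Fin m) (hi : i ∈ T) :
    numAbove (T.erase i) j + (if j < i then 1 else 0) = numAbove T j := by
  rw [numAbove, numAbove, Finset.filter_erase]
  split_ifs with h
  · exact Finset.card_erase_add_one (Finset.mem_filter.2 ⟨hi, h⟩)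
  · rw [Finset.erase_eq_of_notMem (by simp [h]), add_zero]

theorem numAbove_eq_of_lt (I : Finset (Fin m)) {i k : Fin m} (h : i < k) :
    numAbove I i = (I ∩ Finset.Ioo i k).card + (if k ∈ I then 1 else 0) + numAbove I k := by
  have h1 : I.filter (i < ·) = (I ∩ Finset.Ioo i k) ∪ (I.filter (· = k) ∪ I.filter (k < ·)) := by
    ext x
    simp only [Finset.mem_union, Finset.mem_filter, Finset.mem_inter, Finset.mem_Ioo]
    constructor
    · rintro ⟨hx, hix⟩
      rcases lt_trichotomy x k with h' | h' | h' <;> tauto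
    · rintro (h' | ⟨h', rfl⟩ | h')
      · tauto
      · tauto
      · exact ⟨h'.1, h.trans h'.2⟩
  rw [numAbove, h1, Finset.card_union_of_disjoint, Finset.card_union_of_disjoint, ← numAbove,
    ← add_assoc]
  · congr 2
    split_ifs with hk
    · rw [Finset.card_eq_one]
      exact ⟨k, by ext x; simp only [Finset.mem_filter, Finset.mem_singleton]; grind⟩
    · rw [Finset.card_eq_zero]
      ext x; simp only [Finset.mem_filter]; grind
  · rw [Finset.disjoint_left]; simp only [Finset.mem_filter]; grind
  · rw [Finset.disjoint_left]
    simp only [Finset.mem_filter, Finset.mem_inter, Finset.mem_union, Finset.mem_Ioo]; grind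

/-- The sign of the minor that omits the row `k` and the column `i`, both outside `I`: the relative
position of `i` and `k` in the complement of `I` is determined by their position among all indices
and by the elements of `I` between them. -/
theorem neg_one_pow_numAbove_of_notMem {I : Finset (Fin m)} {i k : Fin m} (hi : i ∉ I)
    (hk : k ∉ I) :
    (-1 : S) ^ (numAbove (Iᶜ.erase i) i + numAbove Iᶜ k) =
      (-1) ^ ((i : ℕ) + k + numBetween I k i) := by
  rw [neg_one_pow_eq_pow_mod_two, neg_one_pow_eq_pow_mod_two (n := (i : ℕ) + k + _)]
  congr 1
  have h1 := numAbove_add_numAbove_compl I i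
  have h2 := numAbove_add_numAbove_compl I k
  have h3 := numAbove_erase Iᶜ i i (Finset.mem_compl.2 hi)
  rw [if_neg (lt_irrefl i), add_zero] at h3
  rw [h3, numBetween]
  rcases lt_trichotomy i k with h | rfl | h
  · have h4 := numAbove_eq_of_lt I h
    rw [if_neg hk] at h4
    rw [min_eq_right h.le, max_eq_left h.le]
    omega
  · simp
    omega
  · have h4 := numAbove_eq_of_lt I h
    rw [if_neg hi] at h4
    rw [min_eq_left h.le, max_eq_right h.le]
    omega

/-- The sign of the minor in which a column `k ∈ I` replaces the column `i ∉ I`. -/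
theorem neg_one_pow_numAbove_of_mem {I : Finset (Fin m)} {i k : Fin m} (hi : i ∉ I)
    (hk : k ∈ I) :
    (-1 : S) ^ (numAbove (Iᶜ.erase i) i + numAbove (Iᶜ.erase i) k) =
      -(-1) ^ ((i : ℕ) + k + numBetween I k i) := by
  rw [← neg_one_mul (((-1 : S)) ^ _), ← pow_succ',
    neg_one_pow_eq_pow_mod_two, neg_one_pow_eq_pow_mod_two (n := (i : ℕ) + k + _ + 1)]
  congr 1
  have h1 := numAbove_add_numAbove_compl I i
  have h2 := numAbove_add_numAbove_compl I k
  have h3 := numAbove_erase Iᶜ i i (Finset.mem_compl.2 hi)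
  have h5 := numAbove_erase Iᶜ i k (Finset.mem_compl.2 hi)
  rw [if_neg (lt_irrefl i), add_zero] at h3
  rw [h3, numBetween]
  rcases lt_trichotomy i k with h | rfl | h
  · have h4 := numAbove_eq_of_lt I h
    rw [if_pos hk] at h4
    rw [if_neg h.not_gt] at h5
    rw [min_eq_right h.le, max_eq_left h.le]
    omega
  · exact absurd hk hi
  · have h4 := numAbove_eq_of_lt I h
    rw [if_neg hi] at h4
    rw [if_pos h] at h5
    rw [min_eq_left h.le, max_eq_right h.le]
    omega

/-- Cramer's rule over a right-quantum matrix `C`. The rows outside `I` give linear equations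
`∑ j, C t j * f j = g t`, in which the unknowns `f j` with `j ∈ I` have the known values `g j`;
the solution is a combination of minors for the known quantities of both kinds. -/
theorem ncMinor_mul_eq_sum {C : Matrix (Fin m) (Fin m) S} (hC : IsRightQuantum C)
    {I : Finset (Fin m)} {f g : Fin m → S} (hf : ∀ k ∈ I, f k = g k)
    (hg : ∀ k ∉ I, ∑ j, C k j * f j = g k) {i : Fin m} (hi : i ∉ I) :
    ncMinor C I I * f i = ∑ k, (-1) ^ ((i : ℕ) + k + numBetween I k i) *
      ncMinor C (insert k I) ((insert k I \ {k}) ∪ {i}) * g k := by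
  have hiT : i ∈ Iᶜ := Finset.mem_compl.2 hi
  have hcard : Iᶜ.card = (Iᶜ.erase i).card + 1 := (Finset.card_erase_add_one hiT).symm
  set V := Iᶜ.erase i with hV
  -- Multiply the equation of row `t` by the cofactor of `t` with respect to the columns `V`, and
  -- sum over `t`; the unknowns indexed by `V` drop out.
  have h1 : ∑ t ∈ Iᶜ, (-1) ^ numAbove Iᶜ t * subDet C (Iᶜ.erase t) V * g t =
      ∑ j, (if j ∈ V then 0 else (-1) ^ numAbove V j * subDet C Iᶜ (insert j V)) * f j := by
    calc _ = ∑ t ∈ Iᶜ, ∑ j, (-1) ^ numAbove Iᶜ t * subDet C (Iᶜ.erase t) V * C t j * f j := by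
          refine Finset.sum_congr rfl fun t ht => ?_
          rw [← hg t (Finset.mem_compl.1 ht), Finset.mul_sum]
          simp only [mul_assoc]
      _ = _ := by
          rw [Finset.sum_comm]
          refine Finset.sum_congr rfl fun j _ => ?_
          rw [← sum_subDet_erase_mul hC hcard j, Finset.sum_mul]
  have h2 : ∑ j, (if j ∈ V then 0 else (-1) ^ numAbove V j * subDet C Iᶜ (insert j V)) * f j =
      (-1) ^ numAbove V i * (ncMinor C I I * f i) +
        ∑ j ∈ I, (-1) ^ numAbove V j * subDet C Iᶜ (insert j V) * g j := by
    have hVc : (Finset.univ : Finset (Fin m)) = V ∪ insert i I := by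
      ext x; simp only [hV, Finset.mem_univ, Finset.mem_union, Finset.mem_erase,
        Finset.mem_compl, Finset.mem_insert]; tauto
    have hd : Disjoint V (insert i I) := by
      rw [Finset.disjoint_left]
      simp only [hV, Finset.mem_erase, Finset.mem_compl, Finset.mem_insert]; tauto
    rw [hVc, Finset.sum_union hd, Finset.sum_insert hi, Finset.sum_eq_zero (s := V), zero_add]
    · congr 1
      · rw [if_neg (by simp [hV]), hV, Finset.insert_erase hiT, subDet_compl, mul_assoc]
      · refine Finset.sum_congr rfl fun j hj => ?_
        rw [if_neg (by simp [hV, hj]), hf j hj]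
    · intro j hj
      rw [if_pos hj, zero_mul]
  have h3 : ncMinor C I I * f i =
      ∑ t ∈ Iᶜ, (-1) ^ (numAbove V i + numAbove Iᶜ t) * subDet C (Iᶜ.erase t) V * g t -
        ∑ j ∈ I, (-1) ^ (numAbove V i + numAbove V j) * subDet C Iᶜ (insert j V) * g j := by
    have h4 := eq_sub_of_add_eq (h1.trans h2).symm
    have h5 := congrArg ((-1 : S) ^ numAbove V i * ·) h4
    simp only [← mul_assoc, ← pow_add, mul_sub, Finset.mul_sum] at h5
    simpa [← two_mul, pow_mul] using h5
  have hset : ∀ k, (insert k I \ {k}) ∪ {i} = insert i (I.erase k) := by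
    intro k; ext x; simp; tauto
  rw [h3, ← Finset.sum_compl_add_sum I, sub_eq_add_neg, ← Finset.sum_neg_distrib]
  congr 1
  · refine Finset.sum_congr rfl fun k hk => ?_
    have hkI : k ∉ I := Finset.mem_compl.1 hk
    rw [hV, neg_one_pow_numAbove_of_notMem hi hkI, ← Finset.compl_insert, ← Finset.compl_insert,
      subDet_compl, hset, Finset.erase_eq_of_notMem hkI]
  · refine Finset.sum_congr rfl fun k hk => ?_
    have hik : i ≠ k := fun h => hi (h ▸ hk)
    have hc : insert k V = (insert i (I.erase k))ᶜ := by
      ext x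
      simp only [hV, Finset.mem_insert, Finset.mem_erase, Finset.mem_compl]
      by_cases h : x = k
      · subst h; simp [hik.symm]
      · simp [h]
    rw [hc, hV, neg_one_pow_numAbove_of_mem hi hk, subDet_compl, hset, Finset.insert_eq_of_mem hk]
    simp

end Minors

/-! ### The coefficients `G(p; r)` -/

section Coefficients

open MvPowerSeries

variable {R : Type*} [Ring R] {m : ℕ} {A : Matrix (Fin m) (Fin m) R}

theorem C_mul_X_eq_monomial (a : R) (i : Fin m) :
    C (σ := Fin m) a * X i = monomial (Finsupp.single i 1) a := by
  rw [← monomial_zero_eq_C_apply, X, monomial_mul_monomial, zero_add, mul_one]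

theorem X_mul_C_eq_monomial (a : R) (i : Fin m) :
    X i * C (σ := Fin m) a = monomial (Finsupp.single i 1) a := by
  rw [X_mul, C_mul_X_eq_monomial]

/-- The linear forms `∑ j, a_{ij} x_j` of a right-quantum matrix commute with each other. -/
theorem IsRightQuantum.commute_linearForm (hA : IsRightQuantum A) (i i' : Fin m) :
    Commute (∑ j : Fin m, C (σ := Fin m) (A i j) * X j)
      (∑ j : Fin m, C (σ := Fin m) (A i' j) * X j) := by
  rw [commute_iff_eq, ← sub_eq_zero, Finset.sum_mul_sum, Finset.sum_mul_sum,
    ← Finset.sum_product', ← Finset.sum_product', ← Finset.sum_sub_distrib]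
  simp only [C_mul_X_eq_monomial, monomial_mul_monomial, ← map_sub]
  refine Finset.sum_involution (fun q _ => q.swap) ?_ ?_ ?_ ?_
  · rintro ⟨k, l⟩ _
    simp only [Prod.fst_swap, Prod.snd_swap]
    rw [add_comm (Finsupp.single l 1), ← map_add]
    by_cases h : k = l
    · subst h
      rw [hA.1 i i' k, sub_self, add_zero, map_zero]
    · have h1 : A i k * A i' l - A i' k * A i l + (A i l * A i' k - A i' l * A i k) = 0 := by
        rw [hA.2 i i' k l h]
        abel
      rw [h1, map_zero]
  · rintro ⟨k, l⟩ _ hne heq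
    obtain rfl : l = k := congrArg Prod.fst heq
    apply hne
    dsimp only
    rw [hA.1 i i' l, sub_self, map_zero]
  · intro q _
    simp
  · intro q _
    exact Prod.swap_swap q

theorem prod_ofFn_pow_add_single {M : Type*} [Monoid M] {n : ℕ} (y : Fin n → M)
    (hy : ∀ i j, Commute (y i) (y j)) (p q : Fin n → ℕ) (i : Fin n) (hi : q i = p i + 1)
    (hne : ∀ j, j ≠ i → q j = p j) :
    (List.ofFn fun j => y j ^ q j).prod = y i * (List.ofFn fun j => y j ^ p j).prod := by
  induction n with
  | zero => exact i.elim0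
  | succ n ih =>
    rw [List.ofFn_succ, List.ofFn_succ, List.prod_cons, List.prod_cons]
    cases i using Fin.cases with
    | zero =>
      rw [hi, pow_succ', mul_assoc]
      congr 4
      funext j
      rw [hne _ (Fin.succ_ne_zero j)]
    | succ i =>
      rw [ih (fun j => y j.succ) (fun _ _ => hy _ _) (fun j => p j.succ) (fun j => q j.succ) i hi
        (fun j hj => hne _ fun h => hj (Fin.succ_injective _ h)), hne _ (Fin.succ_ne_zero i).symm,
        ← mul_assoc, ← mul_assoc, ((hy 0 i.succ).pow_left _).eq]

theorem macG_zero_zero (A : Matrix (Fin m) (Fin m) R) : macG A 0 0 = 1 := by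
  simp [macG, List.ofFn_const]

/-- As the linear forms commute, a factor `∑ j, a_{ij} x_j` can be split off on the left. -/
theorem IsRightQuantum.macG_add_single (hA : IsRightQuantum A) (p r : Fin m →₀ ℕ) (i : Fin m) :
    macG A (p + Finsupp.single i 1) r =
      ∑ j, if Finsupp.single j 1 ≤ r then A i j * macG A p (r - Finsupp.single j 1) else 0 := by
  rw [macG, prod_ofFn_pow_add_single _ hA.commute_linearForm p _ i (by simp)
    (fun j hj => by simp [Finsupp.single_eq_of_ne hj]), Finset.sum_mul, map_sum]
  refine Finset.sum_congr rfl fun j _ => ?_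
  rw [C_mul_X_eq_monomial, coeff_monomial_mul]
  rfl

end Coefficients

/-! ### Generating functions with vanishing exponents -/

section RestrictedSeries

open MvPowerSeries

variable {R : Type*} [Ring R] {m : ℕ} {A : Matrix (Fin m) (Fin m) R}

open Classical in
/-- The part of the generating function `macF A d` consisting of the terms `G(p; r) x ^ p` with
`p i = 0` for all `i ∈ I`. -/
noncomputable def restrF (A : Matrix (Fin m) (Fin m) R) (I : Finset (Fin m)) (d : Fin m → ℤ) :
    MvPowerSeries (Fin m) R :=
  fun p : Fin m →₀ ℕ => if ∀ i ∈ I, p i = 0 then coeff p (macF A d) else 0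

theorem restrF_empty (A : Matrix (Fin m) (Fin m) R) (d : Fin m → ℤ) :
    restrF A ∅ d = macF A d := by
  funext p
  simp [restrF, coeff_apply]

theorem coeff_macF_of_eq (A : Matrix (Fin m) (Fin m) R) {d : Fin m → ℤ} {p r : Fin m →₀ ℕ}
    (h : ∀ i, (p i : ℤ) = r i + d i) : coeff p (macF A d) = macG A p r := by
  have h' : ∀ i, 0 ≤ (p i : ℤ) - d i := fun i => by rw [h i]; simp
  rw [coeff_apply, macF, if_pos h']
  congr 1
  ext i
  simp [h i]

theorem coeff_macF_of_lt (A : Matrix (Fin m) (Fin m) R) {d : Fin m → ℤ} {p : Fin m →₀ ℕ}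
    {i : Fin m} (h : (p i : ℤ) < d i) : coeff p (macF A d) = 0 := by
  rw [coeff_apply, macF, if_neg]
  intro h'
  have := h' i
  omega

theorem coeff_restrF_of_forall (A : Matrix (Fin m) (Fin m) R) {I : Finset (Fin m)}
    (d : Fin m → ℤ) {p : Fin m →₀ ℕ} (h : ∀ i ∈ I, p i = 0) :
    coeff p (restrF A I d) = coeff p (macF A d) := by
  rw [coeff_apply, restrF, if_pos h]

theorem coeff_restrF_of_ne_zero (A : Matrix (Fin m) (Fin m) R) {I : Finset (Fin m)}
    (d : Fin m → ℤ) {p : Fin m →₀ ℕ} {i : Fin m} (hi : i ∈ I) (h : p i ≠ 0) :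
    coeff p (restrF A I d) = 0 := by
  rw [coeff_apply, restrF, if_neg fun h' => h (h' i hi)]

/-- The exponent `p i = r i + d i` cannot vanish if `d i > 0`. -/
theorem restrF_eq_zero (A : Matrix (Fin m) (Fin m) R) {I : Finset (Fin m)} {d : Fin m → ℤ}
    {i : Fin m} (hi : i ∈ I) (hd : 0 < d i) : restrF A I d = 0 := by
  ext p
  by_cases h : p i = 0
  · by_cases h' : ∀ j ∈ I, p j = 0
    · rw [coeff_restrF_of_forall A d h', coeff_macF_of_lt A (i := i) (by omega), map_zero]
    · push Not at h'
      obtain ⟨j, hj, hj'⟩ := h'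
      rw [coeff_restrF_of_ne_zero A d hj hj', map_zero]
  · rw [coeff_restrF_of_ne_zero A d hi h, map_zero]

theorem restrF_univ_zero (A : Matrix (Fin m) (Fin m) R) : restrF A Finset.univ 0 = 1 := by
  classical
  ext p
  rw [coeff_one]
  split_ifs with h
  · subst h
    rw [coeff_restrF_of_forall A _ (by simp), coeff_macF_of_eq A (r := 0) (by simp),
      macG_zero_zero]
  · obtain ⟨i, hi⟩ : ∃ i, p i ≠ 0 := by
      by_contra! h'
      exact h (Finsupp.ext h')
    exact coeff_restrF_of_ne_zero A _ (Finset.mem_univ i) hi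

/-- A term with `p = q + e_i` arises from splitting off one factor `∑ j, a_{ij} x_j`. If the
coefficient of `x_j` is taken from it, the remaining exponents are `q` and `r - e_j`, which belong
to `e_j + d` in place of `e_i + d`. -/
theorem coeff_add_single_restrF (hA : IsRightQuantum A) {I : Finset (Fin m)} {i : Fin m}
    (hi : i ∉ I) (d : Fin m → ℤ) (q : Fin m →₀ ℕ) :
    coeff (q + Finsupp.single i 1) (restrF A I (Pi.single i 1 + d)) =
      ∑ j, A i j * coeff q (restrF A I (Pi.single j 1 + d)) := by
  by_cases hq : ∀ l ∈ I, q l = 0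
  swap
  · push Not at hq
    obtain ⟨l, hl, hl'⟩ := hq
    rw [coeff_restrF_of_ne_zero A _ hl (by simp [hl']), Finset.sum_eq_zero]
    intro j _
    rw [coeff_restrF_of_ne_zero A _ hl hl', mul_zero]
  have hq' : ∀ l ∈ I, (q + Finsupp.single i 1 : Fin m →₀ ℕ) l = 0 := fun l hl => by
    have : l ≠ i := fun h => hi (h ▸ hl)
    simp [hq l hl, Finsupp.single_eq_of_ne this]
  have hcast : ∀ l, ((q + Finsupp.single i 1 : Fin m →₀ ℕ) l : ℤ) =
      q l + (Pi.single i 1 : Fin m → ℤ) l := fun l => by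
    by_cases h : l = i
    · subst h; simp
    · simp [Finsupp.single_eq_of_ne h, Pi.single_eq_of_ne h]
  have hnonneg : ∀ j l, 0 ≤ (Pi.single j 1 : Fin m → ℤ) l := fun j l => by
    by_cases h : l = j
    · subst h; simp
    · simp [Pi.single_eq_of_ne h]
  rw [coeff_restrF_of_forall A _ hq']
  simp only [coeff_restrF_of_forall A _ hq]
  by_cases hd : ∀ l, d l ≤ q l
  · have hr : ∃ r : Fin m →₀ ℕ, ∀ l, (q l : ℤ) = r l + d l :=
      ⟨Finsupp.equivFunOnFinite.symm fun l => ((q l : ℤ) - d l).toNat, fun l => by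
        have := hd l
        simp only [Finsupp.equivFunOnFinite_symm_apply_apply]
        omega⟩
    obtain ⟨r, hr⟩ := hr
    rw [coeff_macF_of_eq A (r := r) (fun l => by
      rw [hcast, hr l, Pi.add_apply]; ring), hA.macG_add_single]
    refine Finset.sum_congr rfl fun j _ => ?_
    split_ifs with hj
    · rw [coeff_macF_of_eq A (r := r - Finsupp.single j 1)]
      intro l
      rw [hr l, Pi.add_apply]
      have hjl := hj l
      by_cases h : l = j
      · subst h
        simp only [Finsupp.single_eq_same, Finsupp.coe_tsub, Pi.sub_apply, Pi.single_eq_same]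
          at hjl ⊢
        omega
      · simp [Finsupp.single_eq_of_ne h, Pi.single_eq_of_ne h]
    · rw [coeff_macF_of_lt A (i := j), mul_zero]
      have hj0 : r j = 0 := by
        by_contra h
        exact hj (Finsupp.single_le_iff.2 (Nat.one_le_iff_ne_zero.2 h))
      simp [hr j, hj0]
  · push Not at hd
    obtain ⟨l, hl⟩ := hd
    rw [coeff_macF_of_lt A (i := l) (by rw [hcast, Pi.add_apply]; omega), Finset.sum_eq_zero]
    intro j _
    have := hnonneg j l
    rw [coeff_macF_of_lt A (i := l) (by rw [Pi.add_apply]; omega), mul_zero]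

theorem oneSubXA_apply (A : Matrix (Fin m) (Fin m) R) (i j : Fin m) :
    oneSubXA A i j = (1 : Matrix (Fin m) (Fin m) (MvPowerSeries (Fin m) R)) i j -
      monomial (Finsupp.single i 1) (A i j) := by
  rw [oneSubXA, Matrix.sub_apply, Matrix.diagonal_mul, Matrix.map_apply, X_mul_C_eq_monomial]

/-- The row `i ∉ I` of the linear system satisfied by the series `restrF A I (e_j + d)`: either
`p i = 0`, or a factor `x_i ∑ j, a_{ij} x_j` can be split off. -/
theorem sum_oneSubXA_mul_restrF (hA : IsRightQuantum A) {I : Finset (Fin m)} {i : Fin m}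
    (hi : i ∉ I) (d : Fin m → ℤ) :
    ∑ j, oneSubXA A i j * restrF A I (Pi.single j 1 + d) =
      restrF A (insert i I) (Pi.single i 1 + d) := by
  simp only [oneSubXA_apply, sub_mul, Finset.sum_sub_distrib, Matrix.one_apply, ite_mul, one_mul,
    zero_mul, Finset.sum_ite_eq, Finset.mem_univ, if_true]
  ext p
  simp only [map_sub, map_sum, coeff_monomial_mul]
  by_cases hp : p i = 0
  · have hle : ¬ Finsupp.single i 1 ≤ p := by
      rw [Finsupp.single_le_iff, hp]
      simp
    simp only [if_neg hle, Finset.sum_const_zero, sub_zero]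
    by_cases h : ∀ l ∈ I, p l = 0
    · rw [coeff_restrF_of_forall A _ h, coeff_restrF_of_forall]
      intro l hl
      rcases Finset.mem_insert.1 hl with rfl | hl
      · exact hp
      · exact h l hl
    · push Not at h
      obtain ⟨l, hl, hl'⟩ := h
      rw [coeff_restrF_of_ne_zero A _ hl hl',
        coeff_restrF_of_ne_zero A _ (Finset.mem_insert_of_mem hl) hl']
  · have hle : Finsupp.single i 1 ≤ p :=
      Finsupp.single_le_iff.2 (Nat.one_le_iff_ne_zero.2 hp)
    obtain ⟨q, rfl⟩ : ∃ q, p = q + Finsupp.single i 1 :=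
      ⟨p - Finsupp.single i 1, (tsub_add_cancel_of_le hle).symm⟩
    simp only [if_pos hle, add_tsub_cancel_right]
    rw [coeff_restrF_of_ne_zero A _ (Finset.mem_insert_self i I) hp,
      coeff_add_single_restrF hA hi, sub_self]

/-- The relations only involve commutators, which do not change if central elements are added to
the entries. -/
theorem IsRightQuantum.one_sub {S : Type*} [Ring S] {B : Matrix (Fin m) (Fin m) S}
    (hB : IsRightQuantum B) : IsRightQuantum (1 - B) := by
  have h1 : ∀ i j (x : S), (1 : Matrix (Fin m) (Fin m) S) i j * x =
      x * (1 : Matrix (Fin m) (Fin m) S) i j := fun i j x => by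
    rw [Matrix.one_apply]
    split_ifs <;> simp
  have h2 : ∀ i j i' j', (1 : Matrix (Fin m) (Fin m) S) i j * B i' j' =
      B i' j' * (1 : Matrix (Fin m) (Fin m) S) i j := fun i j _ _ => h1 i j _
  have h3 : ∀ i j i' j', (1 : Matrix (Fin m) (Fin m) S) i j *
      (1 : Matrix (Fin m) (Fin m) S) i' j' = (1 : Matrix (Fin m) (Fin m) S) i' j' *
      (1 : Matrix (Fin m) (Fin m) S) i j := fun i j _ _ => h1 i j _
  refine ⟨fun i j k => ?_, fun i j k l h => ?_⟩
  · simp only [Matrix.sub_apply, sub_mul, mul_sub, h2, hB.1 i j k, h3 i k j k]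
    abel
  · simp only [Matrix.sub_apply, sub_mul, mul_sub, h2, h3 j l i k, h3 i l j k]
    linear_combination (norm := abel) hB.2 i j k l h

theorem IsRightQuantum.oneSubXA (hA : IsRightQuantum A) : IsRightQuantum (oneSubXA A) := by
  refine IsRightQuantum.one_sub ⟨fun i j k => ?_, fun i j k l h => ?_⟩ <;>
  simp only [Matrix.diagonal_mul, Matrix.map_apply, X_mul_C_eq_monomial, monomial_mul_monomial,
    add_comm (Finsupp.single j 1) (Finsupp.single i 1), ← map_sub]
  · rw [hA.1]
  · rw [hA.2 i j k l h]

/-- Cramer's rule for the series `restrF A I (e_j + d)`. -/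
theorem ncMinor_mul_restrF (hA : IsRightQuantum A) {I : Finset (Fin m)} {i : Fin m}
    (hi : i ∉ I) (d : Fin m → ℤ) :
    ncMinor (oneSubXA A) I I * restrF A I (Pi.single i 1 + d) =
      ∑ k, (-1) ^ ((i : ℕ) + k + numBetween I k i) *
        ncMinor (oneSubXA A) (insert k I) ((insert k I \ {k}) ∪ {i}) *
        restrF A (insert k I) (Pi.single k 1 + d) :=
  ncMinor_mul_eq_sum hA.oneSubXA (f := fun j => restrF A I (Pi.single j 1 + d))
    (fun k hk => by rw [Finset.insert_eq_of_mem hk])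
    (fun k hk => sum_oneSubXA_mul_restrF hA hk d) hi

theorem ncMinor_univ_univ {S : Type*} [Ring S] (B : Matrix (Fin m) (Fin m) S) :
    ncMinor B Finset.univ Finset.univ = 1 := by
  rw [← subDet_compl, subDet_eq B (n := 0) (by simp) (by simp), ncDet]
  simp

theorem ncMinor_empty_empty {S : Type*} [Ring S] (B : Matrix (Fin m) (Fin m) S) :
    ncMinor B ∅ ∅ = ncDet B := by
  have h : (∅ᶜ : Finset (Fin m)).card = m := by simp
  have h' : ∀ j, (∅ᶜ : Finset (Fin m)).orderEmbOfFin h j = j := fun j =>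
    (congrFun (Finset.orderEmbOfFin_unique (f := id) h (by simp) strictMono_id) j).symm
  rw [← subDet_compl, subDet_eq B h h]
  congr 1
  ext i j
  rw [Matrix.submatrix_apply, h', h']

/-- The master theorem for the submatrix of `A` outside `I`. -/
theorem ncMinor_mul_restrF_zero (hA : IsRightQuantum A) (I : Finset (Fin m)) :
    ncMinor (oneSubXA A) I I * restrF A I 0 = 1 := by
  induction h : Iᶜ.card generalizing I with
  | zero =>
    obtain rfl : I = Finset.univ := by simpa using h
    rw [ncMinor_univ_univ, restrF_univ_zero, one_mul]
  | succ n ih =>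
    obtain ⟨i, hi⟩ : Iᶜ.Nonempty := by rw [← Finset.card_pos]; omega
    have hi' : i ∉ I := Finset.mem_compl.1 hi
    -- For `d = -e_i` all terms of Cramer's rule other than `k = i` vanish.
    have key := ncMinor_mul_restrF hA hi' (-Pi.single i 1)
    rw [add_neg_cancel, Finset.sum_eq_single i] at key
    · have hset : (insert i I \ {i}) ∪ {i} = insert i I := by
        ext x; simp
      rw [key, add_neg_cancel, hset, mul_assoc, ih]
      · simp [numBetween, ← two_mul]
      · rw [Finset.compl_insert, Finset.card_erase_of_mem hi, h, Nat.add_sub_cancel]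
    · intro k _ hk
      rw [restrF_eq_zero A (Finset.mem_insert_self k I), mul_zero]
      simp [Pi.single_eq_of_ne hk]
    · simp

theorem constantCoeff_ncMinor_self (A : Matrix (Fin m) (Fin m) R) (I : Finset (Fin m)) :
    constantCoeff (ncMinor (oneSubXA A) I I) = 1 := by
  have h : ((oneSubXA A).submatrix (Iᶜ.orderEmbOfFin rfl) (Iᶜ.orderEmbOfFin rfl)).map
      (constantCoeff (σ := Fin m) (R := R)) = 1 := by
    ext i j
    rw [Matrix.map_apply, Matrix.submatrix_apply, oneSubXA_apply, map_sub,
      ← coeff_zero_eq_constantCoeff_apply, ← coeff_zero_eq_constantCoeff_apply,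
      coeff_monomial_ne (Finsupp.single_ne_zero.2 one_ne_zero).symm, sub_zero,
      Matrix.one_apply, Matrix.one_apply]
    by_cases hij : i = j <;> simp [hij]
  rw [ncMinor, dif_pos rfl, map_ncDet, h, ncDet_one]

theorem isUnit_ncMinor_self (A : Matrix (Fin m) (Fin m) R) (I : Finset (Fin m)) :
    IsUnit (ncMinor (oneSubXA A) I I) := by
  rw [isUnit_iff_constantCoeff, constantCoeff_ncMinor_self]
  exact isUnit_one

theorem restrF_zero (hA : IsRightQuantum A) (I : Finset (Fin m)) :
    restrF A I 0 = Ring.inverse (ncMinor (oneSubXA A) I I) := by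
  rw [← Ring.inverse_mul_cancel_left _ (restrF A I 0) (isUnit_ncMinor_self A I),
    ncMinor_mul_restrF_zero hA, mul_one]

end RestrictedSeries

/-! ### Iterated expansion of the generating function -/

section Iteration

open MvPowerSeries

variable {R : Type*} [Ring R] {m : ℕ} {A : Matrix (Fin m) (Fin m) R}

/-- The displacement vector counting the elements of `P` positively and those of `M` negatively. -/
def displacement (P M : Multiset (Fin m)) : Fin m → ℤ :=
  fun i => (P.count i : ℤ) - M.count i

/-- The quotient `det C^{I,J} * (det C^{I,I})⁻¹` with `I = U ∪ {k}` and `J = (I \ {k}) ∪ {n}`, without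
its sign. -/
noncomputable def pathFactor {S : Type*} [Ring S] (C : Matrix (Fin m) (Fin m) S)
    (U : Finset (Fin m)) (n k : Fin m) : S :=
  ncMinor C (insert k U) ((insert k U \ {k}) ∪ {n}) *
    Ring.inverse (ncMinor C (insert k U) (insert k U))

theorem prevSet_zero {δ : ℕ} (π : Fin (δ + 1) → Fin m) : prevSet π 0 = ∅ := by
  ext x
  simp [prevSet]

theorem prevSet_succ {δ : ℕ} (π : Fin (δ + 1) → Fin m) (k : Fin δ) :
    prevSet π k.succ = insert (π 0) (prevSet (fun j => π j.succ) k) := by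
  ext x
  simp only [prevSet, Finset.mem_image, Finset.mem_Iio, Finset.mem_insert, Fin.exists_fin_succ,
    Fin.succ_lt_succ_iff, Fin.succ_pos, true_and, eq_comm]

theorem headSet_eq_insert {δ : ℕ} (π : Fin δ → Fin m) (k : Fin δ) :
    headSet π k = insert (π k) (prevSet π k) := by
  rw [headSet, prevSet, ← Finset.image_insert, Finset.Iio_insert]

theorem enumerates_succ_iff {δ : ℕ} (π : Fin (δ + 1) → Fin m) (M : Multiset (Fin m)) :
    Enumerates π M ↔ π 0 ∈ M ∧ Enumerates (fun j => π j.succ) (M.erase (π 0)) := by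
  rw [Enumerates, Enumerates, Fin.univ_val_map, Fin.univ_val_map, List.ofFn_succ,
    ← Multiset.cons_coe]
  constructor
  · rintro rfl
    simp
  · rintro ⟨h, h'⟩
    rw [h', Multiset.cons_erase h]

/-- The expansion obtained by applying Cramer's rule to `N 0`, then to `N 1`, and so on. The set `I`
of vanishing exponents grows by the element `k ∈ M` chosen at each application, so the factor of
`π k` involves `I ∪ {π 0, …, π (k - 1)}`. -/
theorem ncMinor_mul_restrF_displacement (hA : IsRightQuantum A) {δ : ℕ} (N : Fin δ → Fin m)
    (M : Multiset (Fin m)) (hM : M.card = δ) (hNM : ∀ k, N k ∉ M) (I : Finset (Fin m))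
    (hNI : ∀ k, N k ∉ I) :
    ncMinor (oneSubXA A) I I * restrF A I (displacement (Finset.univ.val.map N) M) =
      ∑ π : Fin δ → Fin m with Enumerates π M,
        (List.ofFn fun k => (-1) ^ ((N k : ℕ) + π k + numBetween (I ∪ prevSet π k) (π k) (N k)) *
          pathFactor (oneSubXA A) (I ∪ prevSet π k) (N k) (π k)).prod := by
  induction δ generalizing M I with
  | zero =>
    obtain rfl : M = 0 := Multiset.card_eq_zero.1 hM
    have h : displacement (Finset.univ.val.map N) 0 = 0 := by
      ext i
      simp [displacement]
    rw [h, ncMinor_mul_restrF_zero hA]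
    simp [Enumerates]
  | succ δ ih =>
    set d : Fin m → ℤ := displacement (Finset.univ.val.map fun j : Fin δ => N j.succ) M with hd
    have hcons : displacement (Finset.univ.val.map N) M = Pi.single (N 0) 1 + d := by
      ext i
      rw [Fin.univ_val_map, List.ofFn_succ, ← Multiset.cons_coe]
      simp only [hd, displacement, Multiset.count_cons, Fin.univ_val_map, Pi.add_apply,
        Pi.single_apply]
      push_cast
      ring
    have hmem : ∀ k ∈ M, Pi.single k 1 + d =
        displacement (Finset.univ.val.map fun j : Fin δ => N j.succ) (M.erase k) := by
      intro k hk
      ext i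
      have h1 : M.count i = (M.erase k).count i + if i = k then 1 else 0 := by
        rw [← Multiset.count_cons, Multiset.cons_erase hk]
      simp only [hd, displacement, Pi.add_apply, Pi.single_apply, h1]
      push_cast
      ring
    -- For `k ∉ M` the exponent of `x_k` would have to be both positive and zero.
    have hnotmem : ∀ k ∉ M, restrF A (insert k I) (Pi.single k 1 + d) = 0 := by
      intro k hk
      refine restrF_eq_zero A (Finset.mem_insert_self k I) ?_
      simp only [hd, displacement, Pi.add_apply, Pi.single_eq_same, Multiset.count_eq_zero.2 hk]
      omega
    rw [hcons, ncMinor_mul_restrF hA (hNI 0), Finset.sum_filter,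
      ← (Fin.consEquiv fun _ : Fin (δ + 1) => Fin m).sum_comp, Fintype.sum_prod_type]
    refine Finset.sum_congr rfl fun k _ => ?_
    simp only [Fin.consEquiv_apply, enumerates_succ_iff, Fin.cons_zero, Fin.cons_succ,
      List.ofFn_succ, List.prod_cons, prevSet_zero, prevSet_succ, Finset.union_empty,
      Finset.union_insert, ← Finset.insert_union]
    by_cases hk : k ∈ M
    · simp only [hk, true_and]
      rw [← Finset.sum_filter, ← Finset.mul_sum, ← ih (fun j => N j.succ) (M.erase k)
        (by rw [Multiset.card_erase_of_mem hk, hM]; rfl)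
        (fun j h => hNM _ (Multiset.mem_of_mem_erase h)) (insert k I)
        (fun j h => (Finset.mem_insert.1 h).elim (fun h => hNM _ (h ▸ hk)) (hNI _)), hmem k hk,
        pathFactor]
      simp only [mul_assoc]
      rw [Ring.inverse_mul_cancel_left _ _ (isUnit_ncMinor_self A _)]
    · simp [hk, hnotmem k hk]

theorem prod_ofFn_neg_one_pow_mul {S : Type*} [Ring S] {n : ℕ} (a : Fin n → ℕ) (t : Fin n → S) :
    (List.ofFn fun k => (-1) ^ a k * t k).prod =
      (-1) ^ (∑ k, a k) * (List.ofFn t).prod := by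
  induction n with
  | zero => simp
  | succ n ih =>
    rw [List.ofFn_succ, List.ofFn_succ, List.prod_cons, List.prod_cons, ih, Fin.sum_univ_succ,
      pow_add, mul_assoc, mul_assoc, ← mul_assoc (t 0),
      ((Commute.neg_one_right (t 0)).pow_right _).eq, mul_assoc]

end Iteration

/-! ### The multisets of a displacement vector -/

section Multisets

variable {m : ℕ}

theorem count_posMultiset (d : Fin m → ℤ) (i : Fin m) :
    (posMultiset d).count i = (d i).toNat := by
  simp [posMultiset, Multiset.count_sum', Multiset.count_replicate]

theorem count_negMultiset (d : Fin m → ℤ) (i : Fin m) :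
    (negMultiset d).count i = (-d i).toNat :=
  count_posMultiset (-d) i

theorem displacement_posMultiset_negMultiset (d : Fin m → ℤ) :
    displacement (posMultiset d) (negMultiset d) = d := by
  ext i
  rw [displacement, count_posMultiset, count_negMultiset]
  omega

theorem notMem_negMultiset_of_mem_posMultiset {d : Fin m → ℤ} {i : Fin m}
    (h : i ∈ posMultiset d) : i ∉ negMultiset d := by
  rw [← Multiset.count_pos, count_posMultiset] at h
  rw [← Multiset.count_eq_zero, count_negMultiset]
  omega

theorem card_posMultiset_eq {d : Fin m → ℤ} (hd : ∑ i, d i = 0) :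
    (posMultiset d).card = (negMultiset d).card := by
  have h : ((posMultiset d).card : ℤ) - (negMultiset d).card = ∑ i, d i := by
    simp only [posMultiset, negMultiset, Multiset.card_sum, Multiset.card_replicate]
    push_cast
    rw [← Finset.sum_sub_distrib]
    exact Finset.sum_congr rfl fun i _ => by omega
  omega

theorem exists_enumerates (s : Multiset (Fin m)) :
    ∃ N : Fin s.card → Fin m, Enumerates N s := by
  induction s using Quotient.inductionOn with
  | _ l =>
    refine ⟨l.get, ?_⟩
    change Finset.univ.val.map l.get = (l : Multiset (Fin m))
    rw [Fin.univ_val_map, List.ofFn_get]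

theorem sum_val_add_one_of_enumerates {δ : ℕ} {N : Fin δ → Fin m} {s : Multiset (Fin m)}
    (h : Enumerates N s) : ∑ k, ((N k : ℕ) + 1) = indexSum s := by
  -- `indexSum` coerces the multiset to `ℕ` before mapping, which appears as a monadic bind.
  simp only [indexSum, ← h, Multiset.bind_def, Multiset.pure_def, Multiset.bind_singleton,
    Multiset.map_map]
  rfl

end Multisets

/-! ### Rationality -/

section Rationality

open MvPowerSeries

variable {R : Type*} [Ring R] {m : ℕ} {A : Matrix (Fin m) (Fin m) R}

theorem IsRationalIn.intCast (z : ℤ) : IsRationalIn A (z : MvPowerSeries (Fin m) R) := by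
  rw [← map_intCast (C (σ := Fin m) (R := R))]
  exact .coeff _ (intCast_mem _ z)

theorem IsRationalIn.one : IsRationalIn A (1 : MvPowerSeries (Fin m) R) := by
  simpa using IsRationalIn.intCast (A := A) 1

theorem IsRationalIn.zero : IsRationalIn A (0 : MvPowerSeries (Fin m) R) := by
  simpa using IsRationalIn.intCast (A := A) 0

theorem IsRationalIn.neg {f : MvPowerSeries (Fin m) R} (hf : IsRationalIn A f) :
    IsRationalIn A (-f) := by
  simpa using (IsRationalIn.intCast (A := A) (-1)).mul hf

theorem IsRationalIn.neg_one_pow (n : ℕ) :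
    IsRationalIn A ((-1) ^ n : MvPowerSeries (Fin m) R) := by
  simpa using IsRationalIn.intCast (A := A) ((-1) ^ n)

theorem IsRationalIn.sum {ι : Type*} (s : Finset ι) {f : ι → MvPowerSeries (Fin m) R}
    (hf : ∀ i ∈ s, IsRationalIn A (f i)) : IsRationalIn A (∑ i ∈ s, f i) :=
  Finset.sum_induction _ _ (fun _ _ => .add) .zero hf

theorem IsRationalIn.prod_ofFn {n : ℕ} {f : Fin n → MvPowerSeries (Fin m) R}
    (hf : ∀ k, IsRationalIn A (f k)) : IsRationalIn A (List.ofFn f).prod := by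
  induction n with
  | zero => simpa using IsRationalIn.one
  | succ n ih =>
    rw [List.ofFn_succ, List.prod_cons]
    exact (hf 0).mul (ih fun k => hf k.succ)

theorem IsRationalIn.ringInverse {f : MvPowerSeries (Fin m) R} (hf : IsRationalIn A f) :
    IsRationalIn A (Ring.inverse f) := by
  by_cases h : IsUnit f
  · exact .inv hf (Ring.mul_inverse_cancel f h) (Ring.inverse_mul_cancel f h)
  · rw [Ring.inverse_non_unit f h]
    exact .zero

theorem isRationalIn_oneSubXA (i j : Fin m) : IsRationalIn A (oneSubXA A i j) := by
  have h : IsRationalIn A (X i * C (A i j)) :=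
    (IsRationalIn.var i).mul (.coeff _ (Subring.subset_closure ⟨(i, j), rfl⟩))
  rw [oneSubXA_apply, ← X_mul_C_eq_monomial, Matrix.one_apply, sub_eq_add_neg]
  split_ifs
  · exact IsRationalIn.one.add h.neg
  · exact IsRationalIn.zero.add h.neg

theorem isRationalIn_ncMinor (I J : Finset (Fin m)) :
    IsRationalIn A (ncMinor (oneSubXA A) I J) := by
  rw [ncMinor]
  split_ifs
  · exact .sum _ fun σ _ => (IsRationalIn.intCast _).mul
      (.prod_ofFn fun k => isRationalIn_oneSubXA _ _)
  · exact .zero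

end Rationality

theorem macF_eq {R : Type*} [Ring R] {m : ℕ} {A : Matrix (Fin m) (Fin m) R}
    (hA : IsRightQuantum A) {d : Fin m → ℤ} (hd : ∑ i, d i = 0) {δ : ℕ} {N : Fin δ → Fin m}
    (hN : Enumerates N (posMultiset d)) :
    macF A d =
      (-1) ^ (indexSum (negMultiset d) + indexSum (posMultiset d)) *
        Ring.inverse (ncDet (oneSubXA A)) *
        ∑ π : Fin δ → Fin m with Enumerates π (negMultiset d),
          (List.ofFn fun k : Fin δ =>
            (-1) ^ crossCount N π k *
              ncMinor (oneSubXA A) (headSet π k) (swapSet N π k) *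
              Ring.inverse (ncMinor (oneSubXA A) (headSet π k) (headSet π k))).prod := by
  have hcard : (negMultiset d).card = δ := by
    rw [← card_posMultiset_eq hd, ← hN]
    simp
  have hmem : ∀ k, N k ∉ negMultiset d := fun k => by
    refine notMem_negMultiset_of_mem_posMultiset ?_
    rw [← hN]
    exact Multiset.mem_map_of_mem _ (Finset.mem_univ k)
  have key := ncMinor_mul_restrF_displacement hA N (negMultiset d) hcard hmem ∅ (by simp)
  rw [hN, displacement_posMultiset_negMultiset, restrF_empty] at key
  rw [← Ring.inverse_mul_cancel_left _ (macF A d) (isUnit_ncMinor_self A ∅), key,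
    ncMinor_empty_empty, ((Commute.neg_one_left _).pow_left _).eq, mul_assoc]
  congr 1
  rw [Finset.mul_sum]
  refine Finset.sum_congr rfl fun π hπ => ?_
  have hπ' : Enumerates π (negMultiset d) := (Finset.mem_filter.1 hπ).2
  have hsign : ∀ k, (-1 : MvPowerSeries (Fin m) R) ^ ((N k : ℕ) + π k +
      numBetween (∅ ∪ prevSet π k) (π k) (N k)) =
      (-1) ^ (((π k : ℕ) + 1) + ((N k : ℕ) + 1)) * (-1) ^ crossCount N π k := fun k => by
    have h : (N k : ℕ) + π k + numBetween (∅ ∪ prevSet π k) (π k) (N k) + 2 =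
        ((π k : ℕ) + 1) + ((N k : ℕ) + 1) + crossCount N π k := by
      rw [Finset.empty_union, numBetween, crossCount]
      ring
    rw [← pow_add, ← h, pow_add _ _ 2, neg_one_sq, mul_one]
  simp only [hsign, mul_assoc]
  rw [prod_ofFn_neg_one_pow_mul, Finset.sum_add_distrib, sum_val_add_one_of_enumerates hπ',
    sum_val_add_one_of_enumerates hN]
  simp only [pathFactor, Finset.empty_union, swapSet, headSet_eq_insert]

theorem theorem6p1 {R : Type*} [Ring R] {m : ℕ} (A : Matrix (Fin m) (Fin m) R)
    (hA : IsRightQuantum A) :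
    -- the determinants in the denominators below are invertible power series
    (IsUnit (ncDet (oneSubXA A)) ∧ ∀ I : Finset (Fin m), IsUnit (ncMinor (oneSubXA A) I I)) ∧
    -- evaluation of the generating function; `N` lists the positive part of `d` in any order
    (∀ (d : Fin m → ℤ), ∑ i, d i = 0 →
      IsRationalIn A (macF A d) ∧
      (posMultiset d).card = (negMultiset d).card ∧
      ∀ (δ : ℕ) (N : Fin δ → Fin m), Enumerates N (posMultiset d) →
        macF A d =
          (-1) ^ (indexSum (negMultiset d) + indexSum (posMultiset d)) *
            Ring.inverse (ncDet (oneSubXA A)) *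
            ∑ π : Fin δ → Fin m with Enumerates π (negMultiset d),
              (List.ofFn fun k : Fin δ =>
                (-1) ^ crossCount N π k *
                  ncMinor (oneSubXA A) (headSet π k) (swapSet N π k) *
                  Ring.inverse (ncMinor (oneSubXA A) (headSet π k) (headSet π k))).prod) ∧
    -- the right-quantum MacMahon master theorem
    macF A 0 = Ring.inverse (ncDet (oneSubXA A)) := by
  refine ⟨⟨?_, isUnit_ncMinor_self A⟩, fun d hd => ⟨?_, card_posMultiset_eq hd,
    fun δ N hN => macF_eq hA hd hN⟩, ?_⟩
  · rw [← ncMinor_empty_empty]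
    exact isUnit_ncMinor_self A ∅
  · obtain ⟨N, hN⟩ := exists_enumerates (posMultiset d)
    rw [macF_eq hA hd hN, ← ncMinor_empty_empty]
    exact ((IsRationalIn.neg_one_pow _).mul (isRationalIn_ncMinor _ _).ringInverse).mul
      (.sum _ fun π _ => .prod_ofFn fun k => ((IsRationalIn.neg_one_pow _).mul
        (isRationalIn_ncMinor _ _)).mul (isRationalIn_ncMinor _ _).ringInverse)
  · rw [← restrF_empty, restrF_zero hA, ncMinor_empty_empty]
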